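/- Let $n\ge 2$ and $m_1,\dots,m_n\ge 1$ be integers, $V=\mathbb C^{m_1+\dots+m_n}=\{v=(v_{ki}) : 1\le k\le n,\ 1\le i\le m_k\}$, and let $G=S_{m_1}\times\dots\times S_{m_n}$ act on $V$ by permuting, for each $k$, the coordinates $v_{k1},\dots,v_{km_k}$. Fix one of two settings: the analytic one, where $\mathcal M$ and $\mathcal O$ are the sheaves of meromorphic and of holomorphic functions on $V$, or the algebraic one, where they are the sheaves of rational and of regular functions (so that $H^0(V,\mathcal O)$ is the ring of entire functions, respectively of polynomials, on $V$). Let $\mathcal S(V)$ be the skew group ring of finite sums $\sum_i f_i\phi_{\xi_i}$ with $f_i\in H^0(V,\mathcal M)$, $\xi_i\in V$, and product $f\phi_\xi\circ f'\phi_{\xi'}=f\,\phi_\xi(f')\,\phi_{\xi+\xi'}$, where $\phi_\xi(f')(x)=f'(x-\xi)$. The group $G$ acts on it by $g\cdot(f\phi_\xi)=(g\cdot f)\phi_{g\xi}$, where $(g\cdot f)(v)=f(g^{-1}v)$; $\mathcal S(V)^G$ is the ring of invariants. It contains the algebra $H^0(V,\mathcal O^G)$ of $G$-invariant elements of $H^0(V,\mathcal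 O)$ (as $h\mapsto h\phi_0$). The ring $\mathcal S(V)$ acts on $\bigoplus_{x\in V}\mathcal M_x$: $f\phi_\xi$ sends a germ $F\in\mathcal M_v$ to the germ $f\cdot(F\circ\phi_\xi^{-1})\in\mathcal M_{v+\xi}$. Let $\mathfrak O^G=\bigoplus_{\bar x\in V/G}\mathcal O^G_{\bar x}$, where $\mathcal O^G_{\bar x}$ is the space of $G$-invariant elements of $\bigoplus_{x\in\bar x}\mathcal O_x$. For $a\in\mathbb C$ and $1\le k\le n$ let $\xi_k^a\in V$ have $(k,1)$-coordinate $a$ and all other coordinates $0$. A standard element is an element $\sum_{g\in G}g\cdot(f\phi_{\xi_k^a})$ with $f\in H^0(V,\mathcal M)$; a (unital, $\mathbb C$-)subalgebra of $\mathcal S(V)^G$ is a standard algebra of type $\mathbb A$ if it is generated by linear combinations of standard elements. For a character $\chi:G\to\mathbb C^\times$ let $d_\chi=\prod_H\gamma_H^{a_H}$ (defined up to a nonzero scalar), where $H$ runs over the reflecting hyperplanes of $G$ in $V$, $\gamma_H$ is a linear form on $V$ with kernel $H$, and $a_H\ge 0$ is the least integer such that $\chi(\sigma_H)=\det(\sigma_H^*)^{a_H}$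 for the reflection $\sigma_H\in G$ in $H$. A rational Galois order is a subalgebra of $\mathcal S(V)^G$ that contains $H^0(V,\mathcal O^G)$ and is generated over it by finitely many elements $X\in\mathcal S(V)^G$ such that, for each such $X$, there is a character $\chi$ of $G$ for which all coefficients of $d_\chi X$ lie in $H^0(V,\mathcal O)$. Theorem. Let $\mathcal A\subset\mathcal S(V)^G$ be a standard algebra of type $\mathbb A$ that is finitely generated over $H^0(V,\mathcal O^G)$ (that is, generated as an algebra by $H^0(V,\mathcal O^G)$ together with finitely many elements) and that preserves $\mathfrak O^G$, i.e. $X(\mathfrak O^G)\subset\mathfrak O^G$ for all $X\in\mathcal A$. Then $\mathcal A$ is a rational Galois order. -/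

import Mathlib

noncomputable section

namespace GaloisOrder

open Filter Topology

/-! ### Germs of holomorphic and meromorphic functions on `V = ℂ^ι` -/

section Germs

variable {ι : Type} [Fintype ι]

/-- The ring `𝒪_x` of germs at `x` of functions holomorphic near `x`. -/
def holSubring (x : ι → ℂ) : Subring (Germ (𝓝 x) ℂ) where
  carrier := {φ | ∃ f : (ι → ℂ) → ℂ, AnalyticAt ℂ f x ∧ φ = (f : Germ (𝓝 x) ℂ)}
  mul_mem' := by
    rintro _ _ ⟨f, hf, rfl⟩ ⟨g, hg, rfl⟩
    exact ⟨f * g, hf.mul hg, rfl⟩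
  one_mem' := ⟨1, analyticAt_const, rfl⟩
  add_mem' := by
    rintro _ _ ⟨f, hf, rfl⟩ ⟨g, hg, rfl⟩
    exact ⟨f + g, hf.add hg, rfl⟩
  zero_mem' := ⟨0, analyticAt_const, rfl⟩
  neg_mem' := by
    rintro _ ⟨f, hf, rfl⟩
    exact ⟨-f, hf.neg, rfl⟩

/-- The ring `𝒪_x` as a type. -/
abbrev HolGerm (x : ι → ℂ) : Type := holSubring x

/-- The germ at `x` of a function that is holomorphic near `x`. -/
def holGerm (f : (ι → ℂ) → ℂ) (x : ι → ℂ) (hf : AnalyticAt ℂ f x) : HolGerm x :=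
  ⟨(f : Germ (𝓝 x) ℂ), f, hf, rfl⟩

instance (x : ι → ℂ) : Algebra ℂ (HolGerm x) :=
  RingHom.toAlgebra
    { toFun := fun c => holGerm (fun _ => c) x analyticAt_const
      map_one' := rfl
      map_mul' := fun _ _ => rfl
      map_zero' := rfl
      map_add' := fun _ _ => rfl }

/-- The ring `ℳ_x` of germs of meromorphic functions at `x`: the fractions of `𝒪_x`. -/
abbrev MerGerm (x : ι → ℂ) : Type := FractionRing (HolGerm x)

/-- The germ at `x` of a function holomorphic near `x`, as a meromorphic germ. -/
def merGerm (f : (ι → ℂ) → ℂ) (x : ι → ℂ) (hf : AnalyticAt ℂ f x) : MerGerm x :=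
  algebraMap (HolGerm x) (MerGerm x) (holGerm f x hf)

/-- Families `(F_x)_{x ∈ V}` of meromorphic germs. -/
def GermFamily (ι : Type) [Fintype ι] : Type := (x : ι → ℂ) → MerGerm x

instance : CommRing (GermFamily ι) :=
  inferInstanceAs (CommRing ((x : ι → ℂ) → MerGerm x))

instance : Algebra ℂ (GermFamily ι) :=
  inferInstanceAs (Algebra ℂ ((x : ι → ℂ) → MerGerm x))

theorem analyticAt_affine (e : (ι → ℂ) ≃ᵃ[ℂ] (ι → ℂ)) (x : ι → ℂ) :
    AnalyticAt ℂ (fun v => e v) x := by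
  have h : (fun v => e v) = fun v => LinearMap.toContinuousLinearMap
      (e.linear : (ι → ℂ) →ₗ[ℂ] (ι → ℂ)) v + e 0 := by
    funext v
    have := e.map_vadd 0 v
    simpa using this
  rw [h]
  exact ((LinearMap.toContinuousLinearMap _).analyticAt x).add analyticAt_const

theorem analyticAt_comp_symm (e : (ι → ℂ) ≃ᵃ[ℂ] (ι → ℂ)) {x y : ι → ℂ} (h : e x = y)
    {f : (ι → ℂ) → ℂ} (hf : AnalyticAt ℂ f x) : AnalyticAt ℂ (fun v => f (e.symm v)) y := by
  have hx : e.symm y = x := by rw [← h, e.symm_apply_apply]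
  exact AnalyticAt.comp (by rw [hx]; exact hf) (analyticAt_affine e.symm y)

theorem tendsto_symm (e : (ι → ℂ) ≃ᵃ[ℂ] (ι → ℂ)) {x y : ι → ℂ} (h : e x = y) :
    Tendsto e.symm (𝓝 y) (𝓝 x) := by
  have hx : e.symm y = x := by rw [← h, e.symm_apply_apply]
  simpa only [hx] using (analyticAt_affine e.symm y).continuousAt.tendsto

/-- The map `𝒪_x → 𝒪_y`, `f ↦ f ∘ e⁻¹`, for an affine automorphism `e` with `e x = y`. -/
def pushHol (e : (ι → ℂ) ≃ᵃ[ℂ] (ι → ℂ)) {x y : ι → ℂ} (h : e x = y) :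
    HolGerm x →+* HolGerm y where
  toFun φ := ⟨(φ : Germ (𝓝 x) ℂ).compTendsto e.symm (tendsto_symm e h), by
    obtain ⟨_, f, hf, rfl⟩ := φ
    exact ⟨fun v => f (e.symm v), analyticAt_comp_symm e h hf, rfl⟩⟩
  map_one' := rfl
  map_zero' := rfl
  map_mul' := by
    rintro ⟨_, f, hf, rfl⟩ ⟨_, g, hg, rfl⟩
    rfl
  map_add' := by
    rintro ⟨_, f, hf, rfl⟩ ⟨_, g, hg, rfl⟩
    rfl

theorem pushHol_holGerm (e : (ι → ℂ) ≃ᵃ[ℂ] (ι → ℂ)) {x y : ι → ℂ} (h : e x = y)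
    (f : (ι → ℂ) → ℂ) (hf : AnalyticAt ℂ f x) :
    pushHol e h (holGerm f x hf) =
      holGerm (fun v => f (e.symm v)) y (analyticAt_comp_symm e h hf) := rfl

/-- `f ↦ f ∘ e⁻¹` as an isomorphism `𝒪_x ≃ 𝒪_y`. -/
def pushHolEquiv (e : (ι → ℂ) ≃ᵃ[ℂ] (ι → ℂ)) {x y : ι → ℂ} (h : e x = y) :
    HolGerm x ≃+* HolGerm y :=
  RingEquiv.ofRingHom (pushHol e h)
    (pushHol e.symm (by rw [← h, e.symm_apply_apply]))
    (by
      ext φ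
      obtain ⟨_, f, hf, rfl⟩ := φ
      change ((fun v => f (e (e.symm v)) : (ι → ℂ) → ℂ) : Germ (𝓝 y) ℂ) = f
      simp only [e.apply_symm_apply])
    (by
      ext φ
      obtain ⟨_, f, hf, rfl⟩ := φ
      change ((fun v => f (e.symm (e v)) : (ι → ℂ) → ℂ) : Germ (𝓝 x) ℂ) = f
      simp only [e.symm_apply_apply])

/-- `f ↦ f ∘ e⁻¹` as an isomorphism `ℳ_x ≃ ℳ_y`. -/
def push (e : (ι → ℂ) ≃ᵃ[ℂ] (ι → ℂ)) {x y : ι → ℂ} (h : e x = y) :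
    MerGerm x ≃+* MerGerm y :=
  IsFractionRing.ringEquivOfRingEquiv (pushHolEquiv e h)

theorem push_merGerm (e : (ι → ℂ) ≃ᵃ[ℂ] (ι → ℂ)) {x y : ι → ℂ} (h : e x = y)
    (f : (ι → ℂ) → ℂ) (hf : AnalyticAt ℂ f x) :
    push e h (merGerm f x hf) =
      merGerm (fun v => f (e.symm v)) y (analyticAt_comp_symm e h hf) := by
  rw [push, merGerm, IsFractionRing.ringEquivOfRingEquiv_algebraMap]
  rfl

theorem push_one {x : ι → ℂ} (h : (1 : (ι → ℂ) ≃ᵃ[ℂ] (ι → ℂ)) x = x) (φ : MerGerm x) :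
    push 1 h φ = φ := by
  have h' : pushHolEquiv 1 h = RingEquiv.refl _ := by
    ext φ
    obtain ⟨_, f, hf, rfl⟩ := φ
    rfl
  rw [push, h', IsFractionRing.ringEquivOfRingEquiv_refl]
  rfl

theorem push_push {e₁ e₂ : (ι → ℂ) ≃ᵃ[ℂ] (ι → ℂ)} {x y z : ι → ℂ} (h₂ : e₂ x = y)
    (h₁ : e₁ y = z) (h : (e₁ * e₂) x = z) (φ : MerGerm x) :
    push e₁ h₁ (push e₂ h₂ φ) = push (e₁ * e₂) h φ := by
  have h' : pushHolEquiv (e₁ * e₂) h = (pushHolEquiv e₂ h₂).trans (pushHolEquiv e₁ h₁) := by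
    ext φ
    obtain ⟨_, f, hf, rfl⟩ := φ
    rfl
  rw [push, push, push, h',
    IsFractionRing.ringEquivOfRingEquiv_comp (MerGerm x) (MerGerm y) (MerGerm z)]
  rfl

/-- An affine automorphism `e` acts on families of germs by `(e • F)_{e x} = F_x ∘ e⁻¹`. -/
instance : SMul ((ι → ℂ) ≃ᵃ[ℂ] (ι → ℂ)) (GermFamily ι) where
  smul e F := fun y => push e (e.apply_symm_apply y) (F (e.symm y))

theorem smul_apply (e : (ι → ℂ) ≃ᵃ[ℂ] (ι → ℂ)) (F : GermFamily ι) (y : ι → ℂ) :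
    (e • F) y = push e (e.apply_symm_apply y) (F (e.symm y)) := rfl

instance : MulSemiringAction ((ι → ℂ) ≃ᵃ[ℂ] (ι → ℂ)) (GermFamily ι) where
  one_smul F := by
    funext y
    exact push_one _ (F y)
  mul_smul e₁ e₂ F := by
    funext y
    exact (push_push _ _ _ _).symm
  smul_zero e := by funext y; exact (push e _).map_zero
  smul_add e _ _ := by funext y; exact (push e _).map_add _ _
  smul_one e := by funext y; exact (push e _).map_one
  smul_mul e _ _ := by funext y; exact (push e _).map_mul _ _

theorem analyticAt_eval (p : MvPolynomial ι ℂ) (x : ι → ℂ) :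
    AnalyticAt ℂ (fun v => MvPolynomial.eval v p) x :=
  AnalyticOnNhd.eval_mvPolynomial p x (Set.mem_univ x)

/-- The germs of a polynomial function. -/
def polyFam : MvPolynomial ι ℂ →+* GermFamily ι where
  toFun p := fun x => merGerm (fun v => MvPolynomial.eval v p) x (analyticAt_eval p x)
  map_one' := by
    funext x
    refine Eq.trans (congrArg (algebraMap (HolGerm x) (MerGerm x)) ?_) (map_one _)
    refine Subtype.ext (congrArg (fun f : (ι → ℂ) → ℂ => (f : Germ (𝓝 x) ℂ)) ?_)
    funext v; simp
  map_zero' := by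
    funext x
    refine Eq.trans (congrArg (algebraMap (HolGerm x) (MerGerm x)) ?_) (map_zero _)
    refine Subtype.ext (congrArg (fun f : (ι → ℂ) → ℂ => (f : Germ (𝓝 x) ℂ)) ?_)
    funext v; simp
  map_mul' p q := by
    funext x
    refine Eq.trans (congrArg (algebraMap (HolGerm x) (MerGerm x)) ?_) (map_mul _ _ _)
    refine Subtype.ext (congrArg (fun f : (ι → ℂ) → ℂ => (f : Germ (𝓝 x) ℂ)) ?_)
    funext v; simp
  map_add' p q := by
    funext x
    refine Eq.trans (congrArg (algebraMap (HolGerm x) (MerGerm x)) ?_) (map_add _ _ _)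
    refine Subtype.ext (congrArg (fun f : (ι → ℂ) → ℂ => (f : Germ (𝓝 x) ℂ)) ?_)
    funext v; simp

/-- The polynomial `p ∘ e⁻¹`. -/
def polyComp (e : (ι → ℂ) ≃ᵃ[ℂ] (ι → ℂ)) : MvPolynomial ι ℂ →ₐ[ℂ] MvPolynomial ι ℂ :=
  open Classical in
  MvPolynomial.aeval fun i =>
    ∑ j, MvPolynomial.C (e.symm.linear (Pi.single j 1) i) * MvPolynomial.X j +
      MvPolynomial.C (e.symm 0 i)

theorem eval_polyComp (e : (ι → ℂ) ≃ᵃ[ℂ] (ι → ℂ)) (p : MvPolynomial ι ℂ) (v : ι → ℂ) :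
    MvPolynomial.eval v (polyComp e p) = MvPolynomial.eval (e.symm v) p := by
  classical
  induction p using MvPolynomial.induction_on with
  | C a => simp [polyComp]
  | add p q hp hq => rw [map_add, map_add, map_add, hp, hq]
  | mul_X p i hp =>
    rw [map_mul, map_mul, map_mul, hp]
    congr 1
    have h1 : e.symm v = e.symm.linear v + e.symm 0 := by
      have := e.symm.map_vadd 0 v
      simpa using this
    have h2 : e.symm.linear v = ∑ j, v j • e.symm.linear (Pi.single j 1) := by
      conv_lhs => rw [pi_eq_sum_univ' v]
      simp only [map_sum, map_smul]

    rw [h1, h2]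
    simp [polyComp, mul_comm]

theorem smul_polyFam (e : (ι → ℂ) ≃ᵃ[ℂ] (ι → ℂ)) (p : MvPolynomial ι ℂ) :
    e • polyFam p = polyFam (polyComp e p) := by
  funext y
  rw [smul_apply]
  refine (push_merGerm e _ _ (analyticAt_eval p (e.symm y))).trans ?_
  change _ = merGerm (fun v => MvPolynomial.eval v (polyComp e p)) y (analyticAt_eval _ y)
  simp only [eval_polyComp]

theorem polyComp_ne_zero (e : (ι → ℂ) ≃ᵃ[ℂ] (ι → ℂ)) {p : MvPolynomial ι ℂ} (hp : p ≠ 0) :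
    polyComp e p ≠ 0 := by
  intro h
  apply hp
  refine MvPolynomial.funext fun v => ?_
  have := eval_polyComp e p (e v)
  rw [h, e.symm_apply_apply] at this
  rw [← this, map_zero, map_zero]

end Germs

/-! ### The two categories of functions -/

/-- The theory is developed in parallel for meromorphic/holomorphic functions
(`analytic`) and for rational/polynomial functions (`algebraic`). -/
inductive Setting
  | analytic
  | algebraic

section Functions

variable {ι : Type} [Fintype ι]

/-- `F` is a meromorphic function on `V`: locally, its germs are those of a fraction `f / g`. -/
def IsMeromorphic (F : GermFamily ι) : Prop :=
  ∀ x : ι → ℂ, ∃ f g : (ι → ℂ) → ℂ, ∀ᶠ y in 𝓝 x, ∃ (hf : AnalyticAt ℂ f y)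
    (hg : AnalyticAt ℂ g y), holGerm g y hg ∈ nonZeroDivisors (HolGerm y) ∧
      F y * merGerm g y hg = merGerm f y hf

/-- `F` is (the family of germs of) a rational function `p / q` on `V`. -/
def IsRational (F : GermFamily ι) : Prop :=
  ∃ p q : MvPolynomial ι ℂ, q ≠ 0 ∧ F * polyFam q = polyFam p

/-- Global sections of `ℳ`: meromorphic, resp. rational, functions on `V`. -/
def Setting.IsFunction : Setting → GermFamily ι → Prop
  | .analytic => IsMeromorphic
  | .algebraic => IsRational

/-- Elements of the stalk `𝒪_x` inside the germs of meromorphic functions: holomorphic germs,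
resp. germs of rational functions that are regular at `x`. -/
def Setting.IsRegularGerm : Setting → (x : ι → ℂ) → MerGerm x → Prop
  | .analytic, x, φ => φ ∈ (algebraMap (HolGerm x) (MerGerm x)).range
  | .algebraic, x, φ => ∃ p q : MvPolynomial ι ℂ, MvPolynomial.eval x q ≠ 0 ∧
      φ * polyFam q x = polyFam p x

/-- Elements of `H⁰(V, 𝒪)`: entire functions, resp. polynomials. -/
def Setting.IsRegular : Setting → GermFamily ι → Prop
  | .analytic, F => ∃ (f : (ι → ℂ) → ℂ) (hf : ∀ x, AnalyticAt ℂ f x), ∀ x, F x = merGerm f x (hf x)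
  | .algebraic, F => ∃ p : MvPolynomial ι ℂ, F = polyFam p

theorem algebraMap_eq_polyFam (c : ℂ) :
    algebraMap ℂ (GermFamily ι) c = polyFam (MvPolynomial.C c) := by
  funext x
  change algebraMap ℂ (MerGerm x) c = _
  rw [IsScalarTower.algebraMap_apply ℂ (HolGerm x) (MerGerm x)]
  refine congrArg (algebraMap (HolGerm x) (MerGerm x)) ?_
  refine Subtype.ext (congrArg (fun f : (ι → ℂ) → ℂ => (f : Germ (𝓝 x) ℂ)) ?_)
  funext v; simp

theorem merGerm_mul {f g : (ι → ℂ) → ℂ} {x : ι → ℂ} (hf : AnalyticAt ℂ f x)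
    (hg : AnalyticAt ℂ g x) : merGerm (f * g) x (hf.mul hg) = merGerm f x hf * merGerm g x hg :=
  map_mul (algebraMap (HolGerm x) (MerGerm x)) (holGerm f x hf) (holGerm g x hg)

theorem merGerm_add {f g : (ι → ℂ) → ℂ} {x : ι → ℂ} (hf : AnalyticAt ℂ f x)
    (hg : AnalyticAt ℂ g x) : merGerm (f + g) x (hf.add hg) = merGerm f x hf + merGerm g x hg :=
  map_add (algebraMap (HolGerm x) (MerGerm x)) (holGerm f x hf) (holGerm g x hg)

theorem isFunction_polyFam (𝒞 : Setting) (p : MvPolynomial ι ℂ) : 𝒞.IsFunction (polyFam p) := by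
  cases 𝒞 with
  | analytic =>
    refine fun x => ⟨fun v => MvPolynomial.eval v p, 1, Eventually.of_forall fun y =>
      ⟨analyticAt_eval p y, analyticAt_const, one_mem _, ?_⟩⟩
    have h : merGerm (1 : (ι → ℂ) → ℂ) y analyticAt_const = 1 :=
      map_one (algebraMap (HolGerm y) (MerGerm y))
    rw [h, mul_one]
    rfl
  | algebraic => exact ⟨p, 1, one_ne_zero, by rw [map_one, mul_one]⟩

theorem isFunction_mul (𝒞 : Setting) {F F' : GermFamily ι} (h : 𝒞.IsFunction F)
    (h' : 𝒞.IsFunction F') : 𝒞.IsFunction (F * F') := by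
  cases 𝒞 with
  | analytic =>
    intro x
    obtain ⟨f, g, hfg⟩ := h x
    obtain ⟨f', g', hfg'⟩ := h' x
    refine ⟨f * f', g * g', ?_⟩
    filter_upwards [hfg, hfg'] with y ⟨hf, hg, hn, e⟩ ⟨hf', hg', hn', e'⟩
    refine ⟨hf.mul hf', hg.mul hg', mul_mem hn hn', ?_⟩
    rw [merGerm_mul hf hf', merGerm_mul hg hg', ← e, ← e']
    change F y * F' y * _ = _
    ring
  | algebraic =>
    obtain ⟨p, q, hq, e⟩ := h
    obtain ⟨p', q', hq', e'⟩ := h'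
    refine ⟨p * p', q * q', mul_ne_zero hq hq', ?_⟩
    rw [map_mul, map_mul, ← e, ← e']
    ring

theorem isFunction_add (𝒞 : Setting) {F F' : GermFamily ι} (h : 𝒞.IsFunction F)
    (h' : 𝒞.IsFunction F') : 𝒞.IsFunction (F + F') := by
  cases 𝒞 with
  | analytic =>
    intro x
    obtain ⟨f, g, hfg⟩ := h x
    obtain ⟨f', g', hfg'⟩ := h' x
    refine ⟨f * g' + f' * g, g * g', ?_⟩
    filter_upwards [hfg, hfg'] with y ⟨hf, hg, hn, e⟩ ⟨hf', hg', hn', e'⟩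
    refine ⟨(hf.mul hg').add (hf'.mul hg), hg.mul hg', mul_mem hn hn', ?_⟩
    rw [merGerm_add (hf.mul hg') (hf'.mul hg), merGerm_mul hf hg', merGerm_mul hf' hg,
      merGerm_mul hg hg', ← e, ← e']
    change (F y + F' y) * _ = _
    ring
  | algebraic =>
    obtain ⟨p, q, hq, e⟩ := h
    obtain ⟨p', q', hq', e'⟩ := h'
    refine ⟨p * q' + p' * q, q * q', mul_ne_zero hq hq', ?_⟩
    rw [map_mul, map_add, map_mul, map_mul, ← e, ← e']
    ring

theorem isFunction_smul (𝒞 : Setting) (e : (ι → ℂ) ≃ᵃ[ℂ] (ι → ℂ)) {F : GermFamily ι}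
    (h : 𝒞.IsFunction F) : 𝒞.IsFunction (e • F) := by
  cases 𝒞 with
  | analytic =>
    intro x
    obtain ⟨f, g, hfg⟩ := h (e.symm x)
    refine ⟨fun v => f (e.symm v), fun v => g (e.symm v), ?_⟩
    filter_upwards [(tendsto_symm e (e.apply_symm_apply x)).eventually hfg] with
      y ⟨hf, hg, hn, hFg⟩
    have hy := e.apply_symm_apply y
    refine ⟨analyticAt_comp_symm e hy hf, analyticAt_comp_symm e hy hg, ?_, ?_⟩
    · have := MulEquivClass.map_nonZeroDivisors (pushHolEquiv e hy)
      rw [← this]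
      exact ⟨_, hn, rfl⟩
    · rw [← push_merGerm e hy g hg, ← push_merGerm e hy f hf, ← hFg, smul_apply]
      exact ((push e hy).map_mul _ _).symm
  | algebraic =>
    obtain ⟨p, q, hq, h⟩ := h
    refine ⟨polyComp e p, polyComp e q, polyComp_ne_zero e hq, ?_⟩
    rw [← smul_polyFam, ← smul_polyFam, ← h, smul_mul']

/-- The ring of meromorphic, resp. rational, functions on `V`. -/
def functionRing (ι : Type) [Fintype ι] (𝒞 : Setting) : Subalgebra ℂ (GermFamily ι) where
  carrier := {F | 𝒞.IsFunction F}
  mul_mem' := isFunction_mul 𝒞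
  add_mem' := isFunction_add 𝒞
  algebraMap_mem' c := by
    rw [Set.mem_ofPred_eq, algebraMap_eq_polyFam]
    exact isFunction_polyFam 𝒞 _

instance (𝒞 : Setting) :
    MulSemiringAction ((ι → ℂ) ≃ᵃ[ℂ] (ι → ℂ)) (functionRing ι 𝒞) where
  smul e F := ⟨e • (F : GermFamily ι), isFunction_smul 𝒞 e F.2⟩
  one_smul _ := Subtype.ext (one_smul _ _)
  mul_smul _ _ _ := Subtype.ext (mul_smul _ _ _)
  smul_zero _ := Subtype.ext (smul_zero _)
  smul_add _ _ _ := Subtype.ext (smul_add _ _ _)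
  smul_one _ := Subtype.ext (smul_one _)
  smul_mul _ _ _ := Subtype.ext (smul_mul' _ _ _)

theorem coe_smul (𝒞 : Setting) (e : (ι → ℂ) ≃ᵃ[ℂ] (ι → ℂ)) (F : functionRing ι 𝒞) :
    ((e • F : functionRing ι 𝒞) : GermFamily ι) = e • (F : GermFamily ι) := rfl

/-- The translation `φ_ξ : v ↦ ξ + v`. -/
abbrev translation (ξ : ι → ℂ) : (ι → ℂ) ≃ᵃ[ℂ] (ι → ℂ) := AffineEquiv.constVAdd ℂ (ι → ℂ) ξ

/-- `ξ ∈ V` acts on functions by `φ_ξ(f)(v) = f(v - ξ)`. -/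
instance (𝒞 : Setting) : MulSemiringAction (Multiplicative (ι → ℂ)) (functionRing ι 𝒞) :=
  MulSemiringAction.compHom _ (AffineEquiv.constVAddHom ℂ (ι → ℂ))

theorem ofAdd_smul (𝒞 : Setting) (ξ : ι → ℂ) (F : functionRing ι 𝒞) :
    Multiplicative.ofAdd ξ • F = translation ξ • F := rfl

end Functions

/-! ### The skew group ring -/

section SkewRing

variable {ι : Type} [Fintype ι]

/-- The skew group ring `𝒮(V)`: finite sums `∑ f_ξ φ_ξ`, where `f_ξ` is a meromorphic
(resp. rational) function and `ξ ∈ V`, with `f φ_ξ ∘ f' φ_ξ' = f φ_ξ(f') φ_{ξ + ξ'}`. -/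
abbrev SkewRing (ι : Type) [Fintype ι] (𝒞 : Setting) : Type :=
  SkewMonoidAlgebra (functionRing ι 𝒞) (Multiplicative (ι → ℂ))

/-- The element `f φ_ξ`. -/
def term {𝒞 : Setting} (f : functionRing ι 𝒞) (ξ : ι → ℂ) : SkewRing ι 𝒞 :=
  SkewMonoidAlgebra.single (Multiplicative.ofAdd ξ) f

theorem smul_algebraMap (𝒞 : Setting) (g : Multiplicative (ι → ℂ)) (c : ℂ) :
    g • (algebraMap ℂ (functionRing ι 𝒞) c) = algebraMap ℂ (functionRing ι 𝒞) c := by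
  apply Subtype.ext
  change translation g.toAdd • algebraMap ℂ (GermFamily ι) c = algebraMap ℂ (GermFamily ι) c
  rw [algebraMap_eq_polyFam, smul_polyFam]
  simp [polyComp]

theorem smul_smul_comm (𝒞 : Setting) (g : Multiplicative (ι → ℂ)) (c : ℂ)
    (F : functionRing ι 𝒞) : g • (c • F) = c • (g • F) := by
  rw [Algebra.smul_def, Algebra.smul_def, smul_mul', smul_algebraMap]

instance (𝒞 : Setting) : Algebra ℂ (SkewRing ι 𝒞) :=
  Algebra.ofModule
    (fun c X Y => by
      induction X using SkewMonoidAlgebra.induction_on' with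
      | single x a => induction Y using SkewMonoidAlgebra.induction_on' with
        | single y b => simp [SkewMonoidAlgebra.mul_def, SkewMonoidAlgebra.smul_single]
        | add => simp_all [mul_add]
      | add => simp_all [add_mul])
    (fun c X Y => by
      induction X using SkewMonoidAlgebra.induction_on' with
      | single x a => induction Y using SkewMonoidAlgebra.induction_on' with
        | single y b =>
          simp [SkewMonoidAlgebra.mul_def, SkewMonoidAlgebra.smul_single, smul_smul_comm]
        | add => simp_all [mul_add]
      | add => simp_all [add_mul])

/-- The action of `𝒮(V)` on families of germs of meromorphic functions: `f φ_ξ` sends a germ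
`F_v ∈ ℳ_v` to the germ of `f φ_ξ(F_v)` in `ℳ_{v + ξ}`. -/
def act {𝒞 : Setting} (X : SkewRing ι 𝒞) (F : GermFamily ι) : GermFamily ι :=
  X.sum fun ξ f => (f : GermFamily ι) * translation ξ.toAdd • F

variable {G : Type} [Group G] (ρ : G →* ((ι → ℂ) ≃ₗ[ℂ] (ι → ℂ)))

/-- The action of `G` on `𝒮(V)`: `g · (f φ_ξ) = (g · f) φ_{g ξ}`. -/
def conj {𝒞 : Setting} (g : G) (X : SkewRing ι 𝒞) : SkewRing ι 𝒞 :=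
  X.sum fun ξ f => term ((ρ g).toAffineEquiv • f) (ρ g ξ.toAdd)

/-- The set `𝒮(V)^G` of `G`-invariant elements. -/
def invariants (𝒞 : Setting) : Set (SkewRing ι 𝒞) :=
  {X | ∀ g, conj ρ g X = X}

/-- `H⁰(V, 𝒪^G)`, the `G`-invariant regular functions, as a subset of `𝒮(V)`. -/
def invariantFunctions (𝒞 : Setting) : Set (SkewRing ι 𝒞) :=
  {X | ∃ h : functionRing ι 𝒞, 𝒞.IsRegular (h : GermFamily ι) ∧
    (∀ g, (ρ g).toAffineEquiv • h = h) ∧ X = term h 0}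

/-- The vector space `𝔒^G = ⨁_{V/G} 𝒪^G_{x̄}`, where `𝒪^G_{x̄}` consists of the `G`-invariant
elements of `⨁_{x ∈ x̄} 𝒪_x`; that is, the `G`-invariant elements of `⨁_{x ∈ V} 𝒪_x`. -/
def invariantGerms (𝒞 : Setting) : Set (GermFamily ι) :=
  {F | {x | F x ≠ 0}.Finite ∧ (∀ x, 𝒞.IsRegularGerm x (F x)) ∧
    ∀ g, (ρ g).toAffineEquiv • F = F}

/-- `𝒜` preserves `𝔒^G`. -/
def PreservesInvariantGerms {𝒞 : Setting} (𝒜 : Subalgebra ℂ (SkewRing ι 𝒞)) : Prop :=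
  ∀ X ∈ 𝒜, ∀ F ∈ invariantGerms ρ 𝒞, act X F ∈ invariantGerms ρ 𝒞

/-- `𝒜` is finitely generated over `H⁰(V, 𝒪^G)`: it is generated, as an algebra, by
`H⁰(V, 𝒪^G)` and finitely many elements. -/
def FinitelyGeneratedOverInvariants {𝒞 : Setting} (𝒜 : Subalgebra ℂ (SkewRing ι 𝒞)) : Prop :=
  ∃ T : Set (SkewRing ι 𝒞), T.Finite ∧ 𝒜 = Algebra.adjoin ℂ (invariantFunctions ρ 𝒞 ∪ T)

/-! ### Rational Galois orders -/

/-- The subspace of vectors fixed by `g`. -/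
def fixedSpace (g : G) : Submodule ℂ (ι → ℂ) :=
  LinearMap.ker ((ρ g : (ι → ℂ) →ₗ[ℂ] (ι → ℂ)) - LinearMap.id)

/-- `A(G)`: the hyperplanes that are the fixed space of some (pseudo-)reflection in `G`. -/
def reflectionHyperplanes : Set (Submodule ℂ (ι → ℂ)) :=
  {H | IsCoatom H ∧ ∃ g, fixedSpace ρ g = H}

/-- The least `a ≥ 0` with `χ(σ) = det(σ^*) ^ a` for the reflections `σ ∈ G` in `H`, where `σ^*` is
the action of `σ` on `V^*`, of determinant `det(σ⁻¹)`. -/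
def hyperplaneExponent (χ : G →* ℂˣ) (H : Submodule ℂ (ι → ℂ)) : ℕ :=
  sInf {a | ∀ σ, fixedSpace ρ σ = H →
    ((χ σ : ℂˣ) : ℂ) = LinearMap.det (ρ σ⁻¹ : (ι → ℂ) →ₗ[ℂ] (ι → ℂ)) ^ a}

/-- A linear form as a polynomial. -/
def linearPoly (γ : Module.Dual ℂ (ι → ℂ)) : MvPolynomial ι ℂ :=
  open Classical in ∑ i, MvPolynomial.C (γ (Pi.single i 1)) * MvPolynomial.X i

/-- `d` is the polynomial `d_χ = ∏_{H ∈ A(G)} γ_H ^ a_H`, for some choice of linear forms `γ_H` with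
kernel `H`. -/
def IsRelativeInvariantGenerator (χ : G →* ℂˣ) (d : MvPolynomial ι ℂ) : Prop :=
  ∃ γ : Submodule ℂ (ι → ℂ) → Module.Dual ℂ (ι → ℂ),
    (∀ H ∈ reflectionHyperplanes ρ, LinearMap.ker (γ H) = H) ∧
    d = ∏ᶠ H ∈ reflectionHyperplanes ρ, linearPoly (γ H) ^ hyperplaneExponent ρ χ H

/-- A rational Galois order (for a finite group `G` generated by reflections): a subalgebra of
`𝒮(V)^G` that contains `H⁰(V, 𝒪^G)` and is generated over it by finitely many `X ∈ 𝒮(V)^G` such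
that `d_χ X` is holomorphic (resp. polynomial) in `V` for some character `χ` of `G`. -/
def IsRationalGaloisOrder {𝒞 : Setting} (ℛ : Subalgebra ℂ (SkewRing ι 𝒞)) : Prop :=
  (ℛ : Set (SkewRing ι 𝒞)) ⊆ invariants ρ 𝒞 ∧
  invariantFunctions ρ 𝒞 ⊆ ℛ ∧
  ∃ T : Set (SkewRing ι 𝒞), T.Finite ∧ T ⊆ invariants ρ 𝒞 ∧
    (∀ X ∈ T, ∃ (χ : G →* ℂˣ) (d : MvPolynomial ι ℂ), IsRelativeInvariantGenerator ρ χ d ∧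
      ∀ ξ, 𝒞.IsRegular (polyFam d * (X.coeff ξ : GermFamily ι))) ∧
    ℛ = Algebra.adjoin ℂ (invariantFunctions ρ 𝒞 ∪ T)

end SkewRing

/-! ### Standard algebras of type A -/

section Standard

variable {n : ℕ} (m : Fin n → ℕ)

/-- The index set of the coordinates `v_{ki}`, `1 ≤ i ≤ m_k`, `1 ≤ k ≤ n`. -/
abbrev Idx : Type := Σ k : Fin n, Fin (m k)

/-- The group `S_{m_1} × ⋯ × S_{m_n}`. -/
abbrev SymGroup : Type := (k : Fin n) → Equiv.Perm (Fin (m k))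

/-- The action of `S_{m_1} × ⋯ × S_{m_n}` on `V` by permuting, for each `k`, the coordinates
`v_{k1}, …, v_{k m_k}`. -/
def symRep : SymGroup m →* ((Idx m → ℂ) ≃ₗ[ℂ] (Idx m → ℂ)) where
  toFun s :=
    { toFun := fun v p => v ⟨p.1, (s p.1)⁻¹ p.2⟩
      invFun := fun v p => v ⟨p.1, s p.1 p.2⟩
      map_add' := fun _ _ => rfl
      map_smul' := fun _ _ => rfl
      left_inv := fun v => by funext p; simp
      right_inv := fun v => by funext p; simp }
  map_one' := rfl
  map_mul' s t := by
    ext v p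
    simp [mul_inv_rev]

/-- `ξ_k^a = a δ^{k1}`. -/
def xi [∀ k, NeZero (m k)] (k : Fin n) (a : ℂ) : Idx m → ℂ :=
  Pi.single (⟨k, 0⟩ : Idx m) a

/-- The standard elements `∑_{g ∈ G} g · (f φ_{ξ_k^a})` of `𝒮(V)^G`. -/
def standardElements [∀ k, NeZero (m k)] (𝒞 : Setting) : Set (SkewRing (Idx m) 𝒞) :=
  {A | ∃ (f : functionRing (Idx m) 𝒞) (k : Fin n) (a : ℂ),
    A = ∑ g : SymGroup m, conj (symRep m) g (term f (xi m k a))}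

/-- A standard algebra of type A: a subalgebra of `𝒮(V)^G` generated by linear combinations of
standard elements. -/
def IsStandard [∀ k, NeZero (m k)] {𝒞 : Setting} (𝒜 : Subalgebra ℂ (SkewRing (Idx m) 𝒞)) :
    Prop :=
  (𝒜 : Set (SkewRing (Idx m) 𝒞)) ⊆ invariants (symRep m) 𝒞 ∧
  ∃ T : Set (SkewRing (Idx m) 𝒞),
    T ⊆ Submodule.span ℂ (standardElements m 𝒞) ∧ 𝒜 = Algebra.adjoin ℂ T

end Standard

end GaloisOrder

end

/-!
Let `X = ∑ f_ξ φ_ξ` be one of finitely many linear combinations of standard elements that generate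
`𝒜` over `H⁰(V, 𝒪^G)` (`exists_finite_subset_adjoin_union_eq`). All `ξ` with `f_ξ ≠ 0` lie on
coordinate axes. It is shown that `d f_ξ` is regular for the relative invariant `d` of the
determinant character, which is divisible by `∏_{l ≠ i} (v_{ki} - v_{kl})` for all `k`, `i`
(`prod_X_sub_X_dvd`).

Fix a point `y` and `ξ_i = a e_{ki}` with `a ≠ 0`. For a `G`-invariant polynomial `h`, the germs of
`h` along the orbit of `y - ξ_i` form an element `F` of `𝔒^G`, so `X F` is regular at `y`. A shift
by `η` contributes to `(X F)_y` only if `y - η` is in that orbit, and comparing the sums of the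
coordinates in each block shows that then `η` is one of the vectors `ξ_j = a e_{kj}`. Let `c_j` be
`f_{ξ_j}` if `ξ_j` contributes and `0` otherwise. Then `∑ c_j h(v - ξ_j)` is regular at `y`.
Taking `h = 1` and the power sums of the `k`-th block gives the regularity of
`∑ c_j ((v_{kj} - a)^s - v_{kj}^s)`, hence, by induction on the degree, of the moments
`∑ c_j v_{kj}^s` (`sum_mul_pow_mem`). So `∑ c_j q(v_{kj})` is regular for every polynomial `q` with
regular coefficients, and `q(x) = ∏_{l ≠ i} (x - v_{kl})` isolates `c_i = f_{ξ_i}`: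
the germ `f_{ξ_i} ∏_{l ≠ i} (v_{ki} - v_{kl})` is regular at `y` (`mul_prod_sub_mem`,
`coeff_single_mul_prod_mem_regularGerms`). The coefficient `f_0` is regular by the same argument
with `h = 1` (`coeff_zero_mem_regularGerms`).

These statements hold at every point `y`, and a meromorphic (rational) function all of whose germs
are regular is entire (polynomial): `isRegular_of_mem_regularGerms`, by the Nullstellensatz in the
algebraic setting.
-/

noncomputable section

namespace GaloisOrder

open Filter Topology

/-! ### Regularity of germs and of functions -/

section Regularity

variable {ι : Type} [Fintype ι]

theorem polyFam_C_apply (c : ℂ) (x : ι → ℂ) :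
    polyFam (MvPolynomial.C c) x = algebraMap ℂ (MerGerm x) c :=
  (congrFun (algebraMap_eq_polyFam c) x).symm

theorem polyFam_mul_apply (p q : MvPolynomial ι ℂ) (x : ι → ℂ) :
    polyFam (p * q) x = polyFam p x * polyFam q x :=
  congrFun (map_mul polyFam p q) x

theorem polyFam_add_apply (p q : MvPolynomial ι ℂ) (x : ι → ℂ) :
    polyFam (p + q) x = polyFam p x + polyFam q x :=
  congrFun (map_add polyFam p q) x

theorem polyFam_one_apply (x : ι → ℂ) : polyFam (1 : MvPolynomial ι ℂ) x = 1 :=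
  congrFun (map_one polyFam) x

/-- The germ at `x` of polynomial functions, as a homomorphism of algebras `ℂ[V] → ℳ_x`. -/
def polyGerm (x : ι → ℂ) : MvPolynomial ι ℂ →ₐ[ℂ] MerGerm x where
  toFun p := polyFam p x
  map_one' := polyFam_one_apply x
  map_mul' p q := polyFam_mul_apply p q x
  map_zero' := congrFun (map_zero polyFam) x
  map_add' p q := polyFam_add_apply p q x
  commutes' c := polyFam_C_apply c x

/-- The stalk `𝒪_x` as a subalgebra of `ℳ_x`. -/
def regularGerms (𝒞 : Setting) (x : ι → ℂ) : Subalgebra ℂ (MerGerm x) where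
  carrier := {φ | 𝒞.IsRegularGerm x φ}
  mul_mem' {φ ψ} hφ hψ := by
    cases 𝒞 with
    | analytic => exact (algebraMap (HolGerm x) (MerGerm x)).range.mul_mem hφ hψ
    | algebraic =>
      obtain ⟨p, q, hq, h⟩ := hφ
      obtain ⟨p', q', hq', h'⟩ := hψ
      refine ⟨p * p', q * q', by rw [map_mul]; exact mul_ne_zero hq hq', ?_⟩
      rw [polyFam_mul_apply, polyFam_mul_apply, ← h, ← h']
      ring
  add_mem' {φ ψ} hφ hψ := by
    cases 𝒞 with
    | analytic => exact (algebraMap (HolGerm x) (MerGerm x)).range.add_mem hφ hψ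
    | algebraic =>
      obtain ⟨p, q, hq, h⟩ := hφ
      obtain ⟨p', q', hq', h'⟩ := hψ
      refine ⟨p * q' + p' * q, q * q', by rw [map_mul]; exact mul_ne_zero hq hq', ?_⟩
      rw [polyFam_add_apply, polyFam_mul_apply, polyFam_mul_apply, polyFam_mul_apply, ← h, ← h']
      ring
  algebraMap_mem' c := by
    cases 𝒞 with
    | analytic =>
      exact ⟨algebraMap ℂ (HolGerm x) c,
        (IsScalarTower.algebraMap_apply ℂ (HolGerm x) (MerGerm x) c).symm⟩
    | algebraic =>
      exact ⟨MvPolynomial.C c, 1, by simp, by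
        rw [polyFam_one_apply, mul_one, polyFam_C_apply]⟩

theorem polyGerm_mem_regularGerms (𝒞 : Setting) (x : ι → ℂ) (p : MvPolynomial ι ℂ) :
    polyGerm x p ∈ regularGerms 𝒞 x := by
  cases 𝒞 with
  | analytic => exact ⟨_, rfl⟩
  | algebraic => exact ⟨p, 1, by simp, by rw [polyFam_one_apply, mul_one]; rfl⟩

/-! ### From regular germs to regular functions -/

theorem merGerm_eq_merGerm_iff {f g : (ι → ℂ) → ℂ} {x : ι → ℂ} (hf : AnalyticAt ℂ f x)
    (hg : AnalyticAt ℂ g x) : merGerm f x hf = merGerm g x hg ↔ f =ᶠ[𝓝 x] g := by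
  rw [merGerm, merGerm, (IsFractionRing.injective (HolGerm x) (MerGerm x)).eq_iff,
    ← Subtype.coe_inj]
  exact Germ.coe_eq

/-- The identity theorem for polynomials. -/
theorem eq_of_eventuallyEq_eval {p q : MvPolynomial ι ℂ} {x : ι → ℂ}
    (h : (fun v => MvPolynomial.eval v p) =ᶠ[𝓝 x] fun v => MvPolynomial.eval v q) : p = q := by
  refine MvPolynomial.funext fun v => ?_
  exact congrFun (AnalyticOnNhd.eq_of_eventuallyEq (fun y _ => analyticAt_eval p y)
    (fun y _ => analyticAt_eval q y) h) v

theorem polyGerm_injective (x : ι → ℂ) : Function.Injective (polyGerm x) := fun _ _ h =>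
  eq_of_eventuallyEq_eval ((merGerm_eq_merGerm_iff _ _).1 h)

/-- The zeros of a nonzero polynomial are nowhere dense, so that its germs are not zero divisors. -/
theorem holGerm_eval_mem_nonZeroDivisors {q : MvPolynomial ι ℂ} (hq : q ≠ 0) (x : ι → ℂ) :
    holGerm (fun v => MvPolynomial.eval v q) x (analyticAt_eval q x) ∈
      nonZeroDivisors (HolGerm x) := by
  rw [mem_nonZeroDivisors_iff_right]
  rintro ⟨_, f, hf, rfl⟩ h
  have h0 : (fun v => f v * MvPolynomial.eval v q) =ᶠ[𝓝 x] fun _ => 0 :=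
    Germ.coe_eq.1 (congrArg Subtype.val h)
  refine Subtype.ext (Germ.coe_eq.2 ?_)
  filter_upwards [eventually_eventually_nhds.2 h0, hf.eventually_analyticAt] with y hy hfy
  by_contra hne
  refine hq (eq_of_eventuallyEq_eval (x := y) ?_)
  filter_upwards [hy, hfy.continuousAt.eventually_ne hne] with z hz hfz
  simpa using (mul_eq_zero.1 hz).resolve_left hfz

theorem mul_polyGerm_right_cancel {q : MvPolynomial ι ℂ} (hq : q ≠ 0) {x : ι → ℂ}
    {φ ψ : MerGerm x} (h : φ * polyGerm x q = ψ * polyGerm x q) : φ = ψ :=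
  (IsLocalization.map_units (MerGerm x)
    (⟨_, holGerm_eval_mem_nonZeroDivisors hq x⟩ : nonZeroDivisors (HolGerm x))).mul_left_injective h

theorem isRegular_of_isMeromorphic {F : GermFamily ι} (hF : IsMeromorphic F)
    (h : ∀ x, F x ∈ regularGerms .analytic x) : Setting.analytic.IsRegular F := by
  choose φ hφ using h
  choose f hf hfφ using fun x => (φ x).2
  have hF' : ∀ x, F x = merGerm (f x) x (hf x) := fun x => by
    rw [← hφ x]
    exact congrArg (algebraMap (HolGerm x) (MerGerm x)) (Subtype.ext (hfφ x))
  -- A local holomorphic representative at `x` represents `F` at all points near `x`.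
  have key : ∀ x, f x =ᶠ[𝓝 x] fun y => f y y := by
    intro x
    obtain ⟨p, q, hpq⟩ := hF x
    obtain ⟨hp, hq, -, e⟩ := hpq.self_of_nhds
    rw [hF' x] at e
    have e' := (merGerm_eq_merGerm_iff ((hf x).mul hq) hp).1 (by rw [merGerm_mul]; exact e)
    filter_upwards [hpq, eventually_eventually_nhds.2 e', (hf x).eventually_analyticAt] with
      y ⟨hpy, hqy, hn, ey⟩ e'y hfy
    have e2 : merGerm (f x) y hfy * merGerm q y hqy = merGerm (f y) y (hf y) * merGerm q y hqy := by
      rw [← hF' y, ey, ← merGerm_mul]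
      exact (merGerm_eq_merGerm_iff _ _).2 e'y
    have e3 := (IsLocalization.map_units (MerGerm y)
      (⟨_, hn⟩ : nonZeroDivisors (HolGerm y))).mul_left_injective e2
    exact ((merGerm_eq_merGerm_iff _ _).1 e3).self_of_nhds
  refine ⟨fun y => f y y, fun x => (hf x).congr (key x), fun x => ?_⟩
  rw [hF' x]
  exact (merGerm_eq_merGerm_iff _ _).2 (key x)

/-- By the Nullstellensatz, the denominators of an everywhere regular rational function generate
the unit ideal. -/
theorem isRegular_of_isRational {F : GermFamily ι} (hF : IsRational F)
    (h : ∀ x, F x ∈ regularGerms .algebraic x) : Setting.algebraic.IsRegular F := by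
  obtain ⟨p, q, hq, e⟩ := hF
  have ex : ∀ x, F x * polyGerm x q = polyGerm x p := fun x => congrFun e x
  let I : Ideal (MvPolynomial ι ℂ) := (Ideal.span {q}).colon {p}
  have hI : I = ⊤ := by
    by_contra hne
    obtain ⟨M, hM, hIM⟩ := Ideal.exists_le_maximal I hne
    obtain ⟨x, rfl⟩ := (MvPolynomial.isMaximal_iff_eq_vanishingIdeal_singleton).1 hM
    obtain ⟨p', q', hq', e'⟩ := h x
    change F x * polyGerm x q' = polyGerm x p' at e'
    have hmem : q' ∈ I := by
      rw [Submodule.mem_colon_singleton, Ideal.mem_span_singleton]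
      refine ⟨p', polyGerm_injective x ?_⟩
      rw [smul_eq_mul, map_mul, map_mul, ← ex, ← e']
      ring
    exact hq' (by
      have := hIM hmem
      rw [MvPolynomial.mem_vanishingIdeal_singleton_iff] at this
      simpa using this)
  obtain ⟨r, hr⟩ : q ∣ p := by
    have : (1 : MvPolynomial ι ℂ) ∈ I := hI ▸ Submodule.mem_top
    rwa [Submodule.mem_colon_singleton, one_smul, Ideal.mem_span_singleton] at this
  refine ⟨r, funext fun x => mul_polyGerm_right_cancel hq ?_⟩
  rw [ex, hr, map_mul, mul_comm]
  rfl

theorem isRegular_of_mem_regularGerms {𝒞 : Setting} {F : GermFamily ι} (hF : 𝒞.IsFunction F)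
    (h : ∀ x, F x ∈ regularGerms 𝒞 x) : 𝒞.IsRegular F := by
  cases 𝒞 with
  | analytic => exact isRegular_of_isMeromorphic hF h
  | algebraic => exact isRegular_of_isRational hF h

end Regularity

/-! ### Divided differences -/

section Lagrange

variable {K J : Type*} [CommRing K] [Algebra ℂ K] [Fintype J]

/-- If all the weighted sums `∑ c_j ((v_j - a)^(s+1) - v_j^(s+1))` lie in `R`, then so do the
moments `∑ c_j v_j^s`, because the leading coefficient `-(s+1)a` is invertible. -/
theorem sum_mul_pow_mem (R : Subalgebra ℂ K) {a : ℂ} (ha : a ≠ 0) (c v : J → K)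
    (h : ∀ s : ℕ, ∑ j, c j * ((v j - algebraMap ℂ K a) ^ (s + 1) - v j ^ (s + 1)) ∈ R) (s : ℕ) :
    ∑ j, c j * v j ^ s ∈ R := by
  induction s using Nat.strong_induction_on with
  | _ s ih =>
  have e : ∑ j, c j * ((v j - algebraMap ℂ K a) ^ (s + 1) - v j ^ (s + 1)) =
      ∑ t ∈ Finset.range s, ((-a) ^ (s + 1 - t) * ((s + 1).choose t : ℂ)) • ∑ j, c j * v j ^ t +
        (-a * (s + 1)) • ∑ j, c j * v j ^ s := by
    simp only [Finset.smul_sum]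
    rw [Finset.sum_comm, ← Finset.sum_add_distrib]
    refine Finset.sum_congr rfl fun j _ => ?_
    rw [sub_eq_add_neg (v j), add_pow, Finset.sum_range_succ, Finset.sum_range_succ, mul_sub,
      mul_add, mul_add, Finset.mul_sum]
    simp only [Algebra.smul_def, map_mul, map_pow, map_neg, map_natCast, map_add, map_one]
    simp only [Nat.sub_self, pow_zero, Nat.choose_self, Nat.cast_one, mul_one, add_tsub_cancel_left,
      pow_one, Nat.choose_succ_self_right, Nat.cast_add, add_sub_cancel_right]
    congr 1
    · exact Finset.sum_congr rfl fun t _ => by ring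
    · ring
  have hlow : ∑ t ∈ Finset.range s, ((-a) ^ (s + 1 - t) * ((s + 1).choose t : ℂ)) •
      ∑ j, c j * v j ^ t ∈ R :=
    sum_mem fun t ht => R.smul_mem (ih t (Finset.mem_range.1 ht)) _
  have hs : (-a * (s + 1) : ℂ) ≠ 0 :=
    mul_ne_zero (neg_ne_zero.2 ha) (by exact_mod_cast Nat.succ_ne_zero s)
  have := R.smul_mem ((add_mem_cancel_left hlow).1 (e ▸ h s)) (-a * (s + 1))⁻¹
  rwa [inv_smul_smul₀ hs] at this

/-- Evaluating `∏_{l ≠ i} (x - v_l)` against the weights `c_j` isolates the weight `c_i`. -/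
theorem mul_prod_sub_mem [DecidableEq J] (R : Subalgebra ℂ K) (c v : J → K) (hv : ∀ j, v j ∈ R)
    (h : ∀ s : ℕ, ∑ j, c j * v j ^ s ∈ R) (i : J) :
    c i * ∏ l ∈ Finset.univ.erase i, (v i - v l) ∈ R := by
  have hq : ∀ q : Polynomial R, ∑ j, c j * Polynomial.aeval (v j) q ∈ R := by
    intro q
    induction q using Polynomial.induction_on' with
    | add p q hp hq =>
      simp only [map_add, mul_add, Finset.sum_add_distrib]
      exact add_mem hp hq
    | monomial s r =>
      have := mul_mem r.2 (h s)
      rw [Finset.mul_sum] at this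
      convert! this using 2 with j
      rw [Polynomial.aeval_monomial]
      change c j * (r * v j ^ s) = _
      ring
  have hi := hq (∏ l ∈ Finset.univ.erase i, (Polynomial.X - Polynomial.C ⟨v l, hv l⟩))
  have e : ∀ j, Polynomial.aeval (v j)
      (∏ l ∈ Finset.univ.erase i, (Polynomial.X - Polynomial.C (⟨v l, hv l⟩ : R))) =
        ∏ l ∈ Finset.univ.erase i, (v j - v l) := by
    intro j
    rw [map_prod]
    refine Finset.prod_congr rfl fun l _ => ?_
    rw [map_sub, Polynomial.aeval_X, Polynomial.aeval_C]
    rfl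
  simp only [e] at hi
  rwa [Finset.sum_eq_single i (fun j _ hj => by
    rw [Finset.prod_eq_zero (Finset.mem_erase.2 ⟨hj, Finset.mem_univ j⟩) (sub_self _), mul_zero])
    (fun hn => absurd (Finset.mem_univ i) hn)] at hi

end Lagrange

/-! ### The relative invariant of the determinant character -/

section DetCharacter

variable {ι : Type} {G : Type} [Group G] (ρ : G →* ((ι → ℂ) ≃ₗ[ℂ] (ι → ℂ)))

/-- The character `g ↦ det(ρ(g)^*)`: the exponent `a = 1` satisfies the condition of
`hyperplaneExponent` on every hyperplane. -/
def detCharacter : G →* ℂˣ := (LinearEquiv.det.comp ρ)⁻¹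

theorem coe_detCharacter (g : G) :
    ((detCharacter ρ g : ℂˣ) : ℂ) = LinearMap.det (ρ g⁻¹ : (ι → ℂ) →ₗ[ℂ] (ι → ℂ)) := by
  rw [detCharacter, MonoidHom.inv_apply, ← map_inv, MonoidHom.comp_apply, LinearEquiv.coe_det]

theorem hyperplaneExponent_detCharacter_ne_zero {H : Submodule ℂ (ι → ℂ)} {σ : G}
    (hσ : fixedSpace ρ σ = H) (hdet : LinearMap.det (ρ σ⁻¹ : (ι → ℂ) →ₗ[ℂ] (ι → ℂ)) ≠ 1) :
    hyperplaneExponent ρ (detCharacter ρ) H ≠ 0 := by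
  intro h0
  have hne : {a : ℕ | ∀ σ, fixedSpace ρ σ = H → ((detCharacter ρ σ : ℂˣ) : ℂ) =
      LinearMap.det (ρ σ⁻¹ : (ι → ℂ) →ₗ[ℂ] (ι → ℂ)) ^ a}.Nonempty :=
    ⟨1, fun τ _ => by rw [pow_one, coe_detCharacter]⟩
  have h := Nat.sInf_mem hne
  rw [show sInf _ = 0 from h0] at h
  have := h σ hσ
  rw [pow_zero, coe_detCharacter] at this
  exact hdet this

theorem finite_reflectionHyperplanes [Finite G] : (reflectionHyperplanes ρ).Finite :=
  (Set.finite_range (fixedSpace ρ)).subset fun _ h => h.2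

theorem exists_ker_eq_of_isCoatom {H : Submodule ℂ (ι → ℂ)} (hH : IsCoatom H) :
    ∃ γ : Module.Dual ℂ (ι → ℂ), LinearMap.ker γ = H := by
  obtain ⟨γ, hγ, hle⟩ := Submodule.exists_le_ker_of_lt_top H hH.lt_top
  exact ⟨γ, (hH.le_iff.1 hle).resolve_left fun h => hγ (LinearMap.ker_eq_top.1 h)⟩

variable [Fintype ι]

theorem exists_isRelativeInvariantGenerator (χ : G →* ℂˣ) :
    ∃ d, IsRelativeInvariantGenerator ρ χ d := by
  choose! γ hγ using fun (H : Submodule ℂ (ι → ℂ)) (hH : IsCoatom H) => exists_ker_eq_of_isCoatom hH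
  exact ⟨_, γ, fun H hH => hγ H hH.1, rfl⟩

theorem linearPoly_smul (c : ℂ) (γ : Module.Dual ℂ (ι → ℂ)) :
    linearPoly (c • γ) = MvPolynomial.C c * linearPoly γ := by
  simp [linearPoly, Finset.mul_sum, mul_assoc]

theorem linearPoly_dvd_linearPoly {γ δ : Module.Dual ℂ (ι → ℂ)}
    (h : LinearMap.ker γ = LinearMap.ker δ) : linearPoly γ ∣ linearPoly δ := by
  have : δ ∈ Submodule.span ℂ (Set.range fun _ : Unit => γ) :=
    mem_span_of_iInf_ker_le_ker (by simp [h])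
  rw [Set.range_const, Submodule.mem_span_singleton] at this
  obtain ⟨c, rfl⟩ := this
  rw [linearPoly_smul]
  exact dvd_mul_left _ _

/-- Linear forms that define distinct reflecting hyperplanes on which the exponent of `χ` is
positive have a product that divides `d_χ`. -/
theorem prod_linearPoly_dvd [Finite G] {χ : G →* ℂˣ} {d : MvPolynomial ι ℂ}
    (hd : IsRelativeInvariantGenerator ρ χ d) {J : Type*} (s : Finset J)
    (δ : J → Module.Dual ℂ (ι → ℂ))
    (hinj : Set.InjOn (fun j => LinearMap.ker (δ j)) s)
    (hrefl : ∀ j ∈ s, LinearMap.ker (δ j) ∈ reflectionHyperplanes ρ)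
    (hexp : ∀ j ∈ s, hyperplaneExponent ρ χ (LinearMap.ker (δ j)) ≠ 0) :
    ∏ j ∈ s, linearPoly (δ j) ∣ d := by
  classical
  obtain ⟨γ, hγ, rfl⟩ := hd
  rw [finprod_mem_eq_finite_toFinset_prod _ (finite_reflectionHyperplanes ρ)]
  refine (Finset.prod_dvd_prod_of_dvd _
    (fun j => linearPoly (γ (LinearMap.ker (δ j))) ^ hyperplaneExponent ρ χ (LinearMap.ker (δ j)))
    fun j hj => ?_).trans ?_
  · exact (linearPoly_dvd_linearPoly (hγ _ (hrefl j hj)).symm).trans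
      (dvd_pow_self _ (hexp j hj))
  · rw [← Finset.prod_image (f := fun H => linearPoly (γ H) ^ hyperplaneExponent ρ χ H)
      (g := fun j => LinearMap.ker (δ j)) hinj]
    refine Finset.prod_dvd_prod_of_subset _ _ _ fun H hH => ?_
    obtain ⟨j, hj, rfl⟩ := Finset.mem_image.1 hH
    exact (finite_reflectionHyperplanes ρ).mem_toFinset.2 (hrefl j hj)

end DetCharacter

/-! ### The reflections of a product of symmetric groups -/

section Symmetric

variable {n : ℕ} (m : Fin n → ℕ)

theorem symRep_apply (g : SymGroup m) (v : Idx m → ℂ) (p : Idx m) :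
    symRep m g v p = v ⟨p.1, (g p.1)⁻¹ p.2⟩ := rfl

theorem det_symRep (g : SymGroup m) :
    LinearMap.det (symRep m g : (Idx m → ℂ) →ₗ[ℂ] (Idx m → ℂ)) =
      (Equiv.Perm.sign (Equiv.Perm.sigmaCongrRight g⁻¹) : ℤˣ) := by
  have : (symRep m g : (Idx m → ℂ) →ₗ[ℂ] (Idx m → ℂ)) =
      Matrix.toLin' ((Equiv.Perm.sigmaCongrRight g⁻¹).permMatrix ℂ) := by
    refine LinearMap.ext fun v => ?_
    rw [Matrix.toLin'_apply, Matrix.permMatrix_mulVec]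
    rfl
  rw [this, LinearMap.det_toLin', Matrix.det_permutation]

variable {m} {k : Fin n} {i j : Fin (m k)}

/-- The transposition of the coordinates `v_{ki}` and `v_{kj}`. -/
def transposition (k : Fin n) (i j : Fin (m k)) : SymGroup m := Pi.mulSingle k (Equiv.swap i j)

theorem transposition_inv : (transposition k i j)⁻¹ = transposition k i j := by
  rw [transposition, ← Pi.mulSingle_inv, Equiv.swap_inv]

theorem sigmaCongrRight_transposition : Equiv.Perm.sigmaCongrRight (transposition k i j) =
    Equiv.swap (⟨k, i⟩ : Idx m) ⟨k, j⟩ := by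
  ext1 ⟨l, r⟩
  rw [Equiv.Perm.sigmaCongrRight, Equiv.sigmaCongrRight_apply]
  by_cases h : l = k
  · subst h
    simp only [transposition, Pi.mulSingle_eq_same, Equiv.swap_apply_def]
    split_ifs <;> simp_all
  · simp [transposition, Equiv.swap_apply_def, h]

theorem det_symRep_transposition (hij : i ≠ j) :
    LinearMap.det (symRep m (transposition k i j) : (Idx m → ℂ) →ₗ[ℂ] (Idx m → ℂ)) = -1 := by
  rw [det_symRep, transposition_inv, sigmaCongrRight_transposition, Equiv.Perm.sign_swap]
  · simp
  · simpa using hij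

/-- The linear form `v_{ki} - v_{kj}`. -/
def coordSub (k : Fin n) (i j : Fin (m k)) : Module.Dual ℂ (Idx m → ℂ) :=
  LinearMap.proj ⟨k, i⟩ - LinearMap.proj ⟨k, j⟩

theorem coordSub_apply (v : Idx m → ℂ) : coordSub k i j v = v ⟨k, i⟩ - v ⟨k, j⟩ := rfl

theorem linearPoly_coordSub :
    linearPoly (coordSub k i j) = MvPolynomial.X ⟨k, i⟩ - MvPolynomial.X ⟨k, j⟩ := by
  classical
  simp [linearPoly, coordSub_apply, Pi.single_apply, sub_mul, Finset.sum_sub_distrib,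
    apply_ite MvPolynomial.C, ite_mul]

theorem fixedSpace_transposition :
    fixedSpace (symRep m) (transposition k i j) = LinearMap.ker (coordSub k i j) := by
  ext v
  have hv : v ∈ fixedSpace (symRep m) (transposition k i j) ↔
      ∀ p : Idx m, v (Equiv.swap (⟨k, i⟩ : Idx m) ⟨k, j⟩ p) = v p := by
    rw [fixedSpace, LinearMap.mem_ker, LinearMap.sub_apply, sub_eq_zero, funext_iff]
    refine forall_congr' fun p => ?_
    rw [← sigmaCongrRight_transposition]
    conv_rhs => rw [← transposition_inv]
    rfl
  rw [hv, LinearMap.mem_ker, coordSub_apply, sub_eq_zero]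
  constructor
  · intro h
    have := h ⟨k, j⟩
    rwa [Equiv.swap_apply_right] at this
  · intro h p
    rw [Equiv.swap_apply_def]
    split_ifs with h1 h2
    · rw [h1, h]
    · rw [h2, h]
    · rfl

theorem coordSub_ne_zero (hij : i ≠ j) : coordSub k i j ≠ 0 := by
  intro h
  have := LinearMap.congr_fun h (Pi.single ⟨k, i⟩ 1)
  rw [coordSub_apply, Pi.single_eq_same, Pi.single_eq_of_ne (by simpa using hij.symm)] at this
  simp at this

theorem ker_coordSub_mem_reflectionHyperplanes (hij : i ≠ j) :
    LinearMap.ker (coordSub k i j) ∈ reflectionHyperplanes (symRep m) :=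
  ⟨LinearMap.isCoatom_ker_of_surjective (LinearMap.surjective (coordSub_ne_zero hij)),
    _, fixedSpace_transposition⟩

theorem ker_coordSub_injOn (k : Fin n) (i : Fin (m k)) :
    Set.InjOn (fun j => LinearMap.ker (coordSub k i j)) {j | j ≠ i} := by
  intro j hj l hl h
  by_contra hjl
  have : Pi.single (⟨k, j⟩ : Idx m) (1 : ℂ) ∈ LinearMap.ker (coordSub k i l) := by
    rw [LinearMap.mem_ker, coordSub_apply, Pi.single_eq_of_ne (by simpa using Ne.symm hj),
      Pi.single_eq_of_ne (by simpa using Ne.symm hjl), sub_zero]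
  rw [← show LinearMap.ker (coordSub k i j) = LinearMap.ker (coordSub k i l) from h,
    LinearMap.mem_ker, coordSub_apply, Pi.single_eq_same,
    Pi.single_eq_of_ne (by simpa using Ne.symm hj)] at this
  simp at this

theorem prod_X_sub_X_dvd {d : MvPolynomial (Idx m) ℂ}
    (hd : IsRelativeInvariantGenerator (symRep m) (detCharacter (symRep m)) d)
    (k : Fin n) (i : Fin (m k)) :
    ∏ j ∈ Finset.univ.erase i, (MvPolynomial.X ⟨k, i⟩ - MvPolynomial.X ⟨k, j⟩) ∣ d := by
  simp only [← linearPoly_coordSub]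
  have hne : ∀ j ∈ Finset.univ.erase i, j ≠ i := fun j hj => (Finset.mem_erase.1 hj).1
  refine prod_linearPoly_dvd (symRep m) hd _ _ ((ker_coordSub_injOn k i).mono hne)
    (fun j hj => ker_coordSub_mem_reflectionHyperplanes (hne j hj).symm) fun j hj => ?_
  refine hyperplaneExponent_detCharacter_ne_zero (symRep m) fixedSpace_transposition ?_
  rw [transposition_inv, det_symRep_transposition (hne j hj).symm]
  norm_num

end Symmetric

/-! ### Test families supported on an orbit -/

section TestFamilies

variable {ι : Type} {G : Type} [Group G] (ρ : G →* ((ι → ℂ) ≃ₗ[ℂ] (ι → ℂ)))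

/-- The orbit of `x`. -/
def orbit (x : ι → ℂ) : Set (ι → ℂ) := Set.range fun g => ρ g x

theorem mem_orbit_self (x : ι → ℂ) : x ∈ orbit ρ x := ⟨1, by simp⟩

theorem symm_mem_orbit_iff (g : G) (x y : ι → ℂ) :
    (ρ g).toAffineEquiv.symm y ∈ orbit ρ x ↔ y ∈ orbit ρ x := by
  constructor
  · rintro ⟨h, hh⟩
    refine ⟨g * h, ?_⟩
    have hh' : ρ h x = (ρ g).symm y := hh
    simp [hh']
  · rintro ⟨h, rfl⟩
    refine ⟨g⁻¹ * h, ?_⟩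
    change ρ (g⁻¹ * h) x = (ρ g).symm (ρ h x)
    rw [map_mul, map_inv]
    rfl

variable [Fintype ι]

open Classical in
/-- The germs of the constant `1` at the points of `S`, and `0` elsewhere. -/
def indicatorFam (S : Set (ι → ℂ)) : GermFamily ι := fun x => if x ∈ S then 1 else 0

open Classical in
theorem smul_indicatorFam_apply (e : (ι → ℂ) ≃ᵃ[ℂ] (ι → ℂ)) (S : Set (ι → ℂ)) (y : ι → ℂ) :
    (e • indicatorFam S) y = if e.symm y ∈ S then 1 else 0 := by
  rw [smul_apply, indicatorFam, apply_ite (push e _), map_one, map_zero]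

/-- The germs of a `G`-invariant polynomial along one orbit are an element of `𝔒^G`. -/
theorem polyFam_mul_indicatorFam_mem_invariantGerms [Finite G] (𝒞 : Setting)
    {h : MvPolynomial ι ℂ} (hh : ∀ g, polyComp (ρ g).toAffineEquiv h = h) (x : ι → ℂ) :
    polyFam h * indicatorFam (orbit ρ x) ∈ invariantGerms ρ 𝒞 := by
  classical
  have e : ∀ y, (polyFam h * indicatorFam (orbit ρ x)) y =
      polyGerm y h * if y ∈ orbit ρ x then 1 else 0 := fun _ => rfl
  refine ⟨(Set.finite_range fun g => ρ g x).subset fun y hy => ?_, fun y => ?_, fun g => ?_⟩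
  · by_contra hn
    refine hy ?_
    rw [e, if_neg (show y ∉ orbit ρ x from hn), mul_zero]
  · change _ ∈ regularGerms 𝒞 y
    rw [e]
    refine mul_mem (polyGerm_mem_regularGerms 𝒞 y h) ?_
    split_ifs
    exacts [one_mem _, zero_mem _]
  · rw [smul_mul', smul_polyFam, hh]
    congr 1
    funext y
    rw [smul_indicatorFam_apply]
    simp only [symm_mem_orbit_iff]
    rfl

open Classical in
/-- The germ at `y` of `X F`, where `F` consists of the germs of a polynomial `h` along `S`: only
the `ξ` with `y - ξ ∈ S` contribute. -/
theorem act_polyFam_mul_indicatorFam {𝒞 : Setting} (X : SkewRing ι 𝒞) (h : MvPolynomial ι ℂ)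
    (S : Set (ι → ℂ)) (y : ι → ℂ) (s : Finset (ι → ℂ))
    (hs : ∀ ξ, X.coeff (Multiplicative.ofAdd ξ) ≠ 0 → -ξ + y ∈ S → ξ ∈ s) :
    act X (polyFam h * indicatorFam S) y =
      ∑ ξ ∈ s, (X.coeff (Multiplicative.ofAdd ξ) : GermFamily ι) y *
        (if -ξ + y ∈ S then 1 else 0) * polyGerm y (polyComp (translation ξ) h) := by
  have e : act X (polyFam h * indicatorFam S) y =
      ∑ ξ ∈ X.support.map Multiplicative.toAdd.toEmbedding,
        (X.coeff (Multiplicative.ofAdd ξ) : GermFamily ι) y *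
          (if -ξ + y ∈ S then 1 else 0) * polyGerm y (polyComp (translation ξ) h) := by
    rw [act, SkewMonoidAlgebra.sum_def', Finset.sum_map]
    refine (Finset.sum_apply y _ _).trans (Finset.sum_congr rfl fun ξ _ => ?_)
    rw [smul_mul', smul_polyFam]
    change (X.coeff ξ : GermFamily ι) y * (polyFam (polyComp (translation ξ.toAdd) h) y *
      (translation ξ.toAdd • indicatorFam S) y) = _
    rw [smul_indicatorFam_apply, mul_comm (polyFam _ y), mul_assoc]
    rfl
  rw [e]
  refine Finset.sum_congr_of_eq_on_inter (fun ξ hξ hn => ?_) (fun ξ _ hn => ?_) fun _ _ _ => rfl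
  · have hξ' : X.coeff (Multiplicative.ofAdd ξ) ≠ 0 := by
      obtain ⟨ζ, hζ, rfl⟩ := Finset.mem_map.1 hξ
      exact SkewMonoidAlgebra.mem_support_iff.1 hζ
    rw [if_neg fun hy => hn (hs ξ hξ' hy), mul_zero, zero_mul]
  · have hξ : X.coeff (Multiplicative.ofAdd ξ) = 0 := by
      by_contra hξ
      exact hn (Finset.mem_map.2 ⟨_, SkewMonoidAlgebra.mem_support_iff.2 hξ, rfl⟩)
    rw [hξ]
    change (0 : MerGerm y) * _ * _ = 0
    rw [zero_mul, zero_mul]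

end TestFamilies

/-! ### Elements supported on the coordinate axes -/

section Axes

variable {n : ℕ} {m : Fin n → ℕ}

/-- The elements `∑ f_ξ φ_ξ` of `𝒮(V)` for which all `ξ` have at most one nonzero coordinate. -/
def axialElements (m : Fin n → ℕ) (𝒞 : Setting) : Submodule ℂ (SkewRing (Idx m) 𝒞) where
  carrier := {X | ∀ ξ, X.coeff (Multiplicative.ofAdd ξ) ≠ 0 → ∃ p a, ξ = Pi.single p a}
  zero_mem' ξ h := absurd rfl h
  add_mem' {X Y} hX hY ξ h := by
    by_cases h0 : X.coeff (Multiplicative.ofAdd ξ) = 0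
    · refine hY ξ fun h1 => h ?_
      rw [SkewMonoidAlgebra.coeff_add, Finsupp.add_apply, h0, h1, add_zero]
    · exact hX ξ h0
  smul_mem' c X hX ξ h := hX ξ fun h0 => h (by
    change (c • X.coeff) _ = 0
    rw [Finsupp.smul_apply, h0, smul_zero])

theorem conj_term {ι G : Type} [Fintype ι] [Group G] (ρ : G →* ((ι → ℂ) ≃ₗ[ℂ] (ι → ℂ)))
    {𝒞 : Setting} (g : G) (f : functionRing ι 𝒞) (ξ : ι → ℂ) :
    conj ρ g (term f ξ) = term ((ρ g).toAffineEquiv • f) (ρ g ξ) := by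
  rw [conj, term, SkewMonoidAlgebra.sum_single_index]
  · rfl
  · rw [smul_zero, term, SkewMonoidAlgebra.single_zero]

theorem symRep_single (g : SymGroup m) (k : Fin n) (i : Fin (m k)) (a : ℂ) :
    symRep m g (Pi.single ⟨k, i⟩ a) = Pi.single (⟨k, g k i⟩ : Idx m) a := by
  funext ⟨l, j⟩
  rw [symRep_apply, Pi.single_apply, Pi.single_apply]
  refine if_congr ?_ rfl rfl
  constructor
  · intro h
    obtain rfl : l = k := congrArg Sigma.fst h
    simp only [Sigma.mk.injEq, heq_eq_eq, true_and] at h ⊢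
    rw [← h]
    exact ((g l).apply_symm_apply j).symm
  · intro h
    obtain rfl : l = k := congrArg Sigma.fst h
    simp only [Sigma.mk.injEq, heq_eq_eq, true_and] at h ⊢
    rw [h]
    exact (g l).symm_apply_apply i

theorem standardElements_subset_axialElements [∀ k, NeZero (m k)] (𝒞 : Setting) :
    standardElements m 𝒞 ⊆ axialElements m 𝒞 := by
  rintro _ ⟨f, k, a, rfl⟩
  refine sum_mem fun g _ => ?_
  rw [conj_term, xi, symRep_single]
  intro ξ h
  refine ⟨⟨k, g k 0⟩, a, ?_⟩
  rw [term, SkewMonoidAlgebra.coeff_single] at h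
  by_contra hne
  exact h (Finsupp.single_eq_of_ne fun he => hne (Multiplicative.ofAdd.injective he))

/-- The sum of the coordinates in the block `k`. -/
def blockSum (k : Fin n) (v : Idx m → ℂ) : ℂ := ∑ i, v ⟨k, i⟩

theorem blockSum_symRep (k : Fin n) (g : SymGroup m) (v : Idx m → ℂ) :
    blockSum k (symRep m g v) = blockSum k v :=
  Equiv.sum_comp (g k)⁻¹ fun i => v ⟨k, i⟩

theorem blockSum_neg_add (k : Fin n) (v w : Idx m → ℂ) :
    blockSum k (-v + w) = -blockSum k v + blockSum k w := by
  simp [blockSum, Finset.sum_add_distrib]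

theorem blockSum_single (k : Fin n) (i : Fin (m k)) (a : ℂ) :
    blockSum k (Pi.single (⟨k, i⟩ : Idx m) a) = a := by
  simp [blockSum, Pi.single_apply]

theorem blockSum_single_of_ne {k l : Fin n} (h : k ≠ l) (i : Fin (m l)) (a : ℂ) :
    blockSum k (Pi.single (⟨l, i⟩ : Idx m) a) = 0 :=
  Finset.sum_eq_zero fun _ _ => Pi.single_eq_of_ne (fun he => h (congrArg Sigma.fst he)) _

theorem blockSum_eq_of_mem_orbit {ξ η y : Idx m → ℂ} (h : -η + y ∈ orbit (symRep m) (-ξ + y))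
    (k : Fin n) : blockSum k η = blockSum k ξ := by
  obtain ⟨g, hg⟩ := h
  have := congrArg (blockSum k) hg
  dsimp only at this
  rw [blockSum_symRep, blockSum_neg_add, blockSum_neg_add] at this
  exact (neg_injective (add_right_cancel this)).symm

/-- The power sum of degree `s` of the coordinates in the block `k`. -/
def blockPowerSum (k : Fin n) (s : ℕ) : MvPolynomial (Idx m) ℂ :=
  ∑ i, MvPolynomial.X ⟨k, i⟩ ^ s

theorem polyComp_blockPowerSum (k : Fin n) (s : ℕ) (g : SymGroup m) :
    polyComp (symRep m g).toAffineEquiv (blockPowerSum k s) = blockPowerSum k s := by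
  refine MvPolynomial.funext fun v => ?_
  rw [eval_polyComp]
  simp only [blockPowerSum, map_sum, map_pow, MvPolynomial.eval_X]
  exact Equiv.sum_comp (g k) fun i => v ⟨k, i⟩ ^ s

theorem polyComp_translation_blockPowerSum (k : Fin n) (i : Fin (m k)) (a : ℂ) (s : ℕ) :
    polyComp (translation (Pi.single (⟨k, i⟩ : Idx m) a)) (blockPowerSum k s) =
      blockPowerSum k s +
        ((MvPolynomial.X ⟨k, i⟩ - MvPolynomial.C a) ^ s - MvPolynomial.X ⟨k, i⟩ ^ s) := by
  refine MvPolynomial.funext fun v => ?_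
  have hv : ∀ p, (translation (Pi.single (⟨k, i⟩ : Idx m) a)).symm v p =
      -Pi.single (M := fun _ => ℂ) (⟨k, i⟩ : Idx m) a p + v p := fun _ => rfl
  rw [eval_polyComp]
  simp only [blockPowerSum, map_sum, map_pow, map_add, map_sub, MvPolynomial.eval_X,
    MvPolynomial.eval_C, hv]
  rw [← sub_eq_iff_eq_add', ← Finset.sum_sub_distrib, Finset.sum_eq_single i]
  · rw [Pi.single_eq_same, neg_add_eq_sub]
  · intro j _ hj
    rw [Pi.single_eq_of_ne (by simpa using hj), neg_zero, zero_add, sub_self]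
  · exact fun h => absurd (Finset.mem_univ i) h

variable {𝒞 : Setting} {X : SkewRing (Idx m) 𝒞}

/-- If `X` preserves `𝔒^G`, its coefficient at `0` is regular: near `y`, apply `X` to the
germs of `1` along the orbit of `y`. -/
theorem coeff_zero_mem_regularGerms (hX : X ∈ axialElements m 𝒞)
    (hpres : ∀ F ∈ invariantGerms (symRep m) 𝒞, act X F ∈ invariantGerms (symRep m) 𝒞)
    (y : Idx m → ℂ) :
    (X.coeff (Multiplicative.ofAdd 0) : GermFamily (Idx m)) y ∈ regularGerms 𝒞 y := by
  classical
  have h1 : ∀ e : (Idx m → ℂ) ≃ᵃ[ℂ] (Idx m → ℂ), polyComp e 1 = 1 := fun e => map_one _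
  have h := (hpres _ (polyFam_mul_indicatorFam_mem_invariantGerms (symRep m) 𝒞
    (fun g => h1 _) (-0 + y))).2.1 y
  rw [act_polyFam_mul_indicatorFam X 1 _ y {0}, Finset.sum_singleton,
    if_pos (mem_orbit_self _ _), h1, map_one, mul_one, mul_one] at h
  · exact h
  · intro ξ hξ hy
    obtain ⟨⟨k, i⟩, a, rfl⟩ := hX ξ hξ
    have := blockSum_eq_of_mem_orbit hy k
    rw [blockSum_single] at this
    simp [this, blockSum]

/-- If `X` preserves `𝔒^G`, its coefficient at a vector on the axis of `v_{ki}` becomes regular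
after multiplication by `∏_{l ≠ i} (v_{ki} - v_{kl})`. -/
theorem coeff_single_mul_prod_mem_regularGerms (hX : X ∈ axialElements m 𝒞)
    (hpres : ∀ F ∈ invariantGerms (symRep m) 𝒞, act X F ∈ invariantGerms (symRep m) 𝒞)
    (k : Fin n) (i : Fin (m k)) {a : ℂ} (ha : a ≠ 0) (y : Idx m → ℂ) :
    (X.coeff (Multiplicative.ofAdd (Pi.single ⟨k, i⟩ a)) : GermFamily (Idx m)) y *
      polyGerm y (∏ l ∈ Finset.univ.erase i, (MvPolynomial.X ⟨k, i⟩ - MvPolynomial.X ⟨k, l⟩)) ∈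
        regularGerms 𝒞 y := by
  classical
  let ξ : Fin (m k) → Idx m → ℂ := fun j => Pi.single ⟨k, j⟩ a
  have hξ : Function.Injective ξ := by
    intro j l hjl
    by_contra hne
    have := congrFun hjl ⟨k, j⟩
    simp only [ξ, Pi.single_eq_same] at this
    rw [Pi.single_eq_of_ne (by simpa using hne)] at this
    exact ha this
  let c : Fin (m k) → MerGerm y := fun j =>
    (X.coeff (Multiplicative.ofAdd (ξ j)) : GermFamily (Idx m)) y *
      if -ξ j + y ∈ orbit (symRep m) (-ξ i + y) then 1 else 0
  let v : Fin (m k) → MerGerm y := fun j => polyGerm y (MvPolynomial.X ⟨k, j⟩)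
  have hsum : ∀ h : MvPolynomial (Idx m) ℂ,
      (∀ g, polyComp (symRep m g).toAffineEquiv h = h) →
        ∑ j, c j * polyGerm y (polyComp (translation (ξ j)) h) ∈ regularGerms 𝒞 y := by
    intro h hh
    have hF := (hpres _ (polyFam_mul_indicatorFam_mem_invariantGerms (symRep m) 𝒞 hh
      (-ξ i + y))).2.1 y
    rw [act_polyFam_mul_indicatorFam X h _ y (Finset.univ.image ξ),
      Finset.sum_image hξ.injOn] at hF
    · exact hF
    -- The block sums recognize the vectors of the form `ξ j`.
    · intro η hη hy
      obtain ⟨⟨l, j⟩, b, rfl⟩ := hX η hη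
      have hb := blockSum_eq_of_mem_orbit hy k
      rw [blockSum_single] at hb
      by_cases hkl : k = l
      · subst hkl
        rw [blockSum_single] at hb
        rw [hb]
        exact Finset.mem_image_of_mem ξ (Finset.mem_univ j)
      · rw [blockSum_single_of_ne hkl] at hb
        exact absurd hb.symm ha
  have h0 : ∑ j, c j ∈ regularGerms 𝒞 y := by
    have := hsum 1 fun g => map_one _
    simpa only [map_one, mul_one] using this
  have hpow : ∀ s, ∑ j, c j * v j ^ s ∈ regularGerms 𝒞 y := by
    refine sum_mul_pow_mem _ ha c v fun s => ?_
    have hs := hsum (blockPowerSum k (s + 1)) (polyComp_blockPowerSum k (s + 1))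
    simp only [ξ, polyComp_translation_blockPowerSum, map_add, mul_add, Finset.sum_add_distrib,
      ← Finset.sum_mul] at hs
    have := (add_mem_cancel_left
      (mul_mem h0 (polyGerm_mem_regularGerms 𝒞 y (blockPowerSum k (s + 1))))).1 hs
    simpa only [map_sub, map_pow, ← MvPolynomial.algebraMap_eq, AlgHom.commutes] using this
  have := mul_prod_sub_mem _ c v (fun j => polyGerm_mem_regularGerms 𝒞 y _) hpow i
  simp only [c, if_pos (mem_orbit_self _ _), mul_one] at this
  simpa only [map_prod, map_sub] using this

theorem isRegular_mul_coeff (hX : X ∈ axialElements m 𝒞)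
    (hpres : ∀ F ∈ invariantGerms (symRep m) 𝒞, act X F ∈ invariantGerms (symRep m) 𝒞)
    {d : MvPolynomial (Idx m) ℂ}
    (hd : IsRelativeInvariantGenerator (symRep m) (detCharacter (symRep m)) d)
    (ξ : Multiplicative (Idx m → ℂ)) :
    𝒞.IsRegular (polyFam d * (X.coeff ξ : GermFamily (Idx m))) := by
  refine isRegular_of_mem_regularGerms
    (isFunction_mul 𝒞 (isFunction_polyFam 𝒞 d) (X.coeff ξ).2) fun y => ?_
  change polyGerm y d * (X.coeff ξ : GermFamily (Idx m)) y ∈ _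
  by_cases h0 : X.coeff ξ = 0
  · rw [h0]
    change _ * (0 : MerGerm y) ∈ _
    rw [mul_zero]
    exact zero_mem _
  obtain ⟨⟨k, i⟩, a, ha⟩ := hX ξ.toAdd h0
  obtain rfl : ξ = Multiplicative.ofAdd (Pi.single ⟨k, i⟩ a) := ha
  by_cases h : a = 0
  · subst h
    rw [Pi.single_zero]
    exact mul_mem (polyGerm_mem_regularGerms 𝒞 y d) (coeff_zero_mem_regularGerms hX hpres y)
  · obtain ⟨q, rfl⟩ := prod_X_sub_X_dvd hd k i
    rw [map_mul, mul_comm, ← mul_assoc]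
    exact mul_mem (coeff_single_mul_prod_mem_regularGerms hX hpres k i h y)
      (polyGerm_mem_regularGerms 𝒞 y q)

end Axes

/-! ### Finite generation -/

theorem exists_finite_subset_mem_adjoin {A : Type*} [Ring A] [Algebra ℂ A] {S : Set A} {t : A}
    (ht : t ∈ Algebra.adjoin ℂ S) : ∃ T ⊆ S, T.Finite ∧ t ∈ Algebra.adjoin ℂ T := by
  induction ht using Algebra.adjoin_induction with
  | mem x hx => exact ⟨{x}, by simpa using hx, Set.finite_singleton x,
      Algebra.subset_adjoin (Set.mem_singleton x)⟩
  | algebraMap c => exact ⟨∅, Set.empty_subset _, Set.finite_empty, Subalgebra.algebraMap_mem _ c⟩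
  | add x y _ _ hx hy =>
    obtain ⟨T, hT, hf, hx⟩ := hx
    obtain ⟨U, hU, hf', hy⟩ := hy
    exact ⟨T ∪ U, Set.union_subset hT hU, hf.union hf',
      add_mem (Algebra.adjoin_mono Set.subset_union_left hx)
        (Algebra.adjoin_mono Set.subset_union_right hy)⟩
  | mul x y _ _ hx hy =>
    obtain ⟨T, hT, hf, hx⟩ := hx
    obtain ⟨U, hU, hf', hy⟩ := hy
    exact ⟨T ∪ U, Set.union_subset hT hU, hf.union hf',
      mul_mem (Algebra.adjoin_mono Set.subset_union_left hx)
        (Algebra.adjoin_mono Set.subset_union_right hy)⟩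

/-- An algebra that is generated by `S`, and is finitely generated over `B`, is generated over
`B` by finitely many elements of `S`. -/
theorem exists_finite_subset_adjoin_union_eq {A : Type*} [Ring A] [Algebra ℂ A] {B S T : Set A}
    (hT : T.Finite) (h : Algebra.adjoin ℂ (B ∪ T) = Algebra.adjoin ℂ S) :
    ∃ U ⊆ S, U.Finite ∧ Algebra.adjoin ℂ (B ∪ U) = Algebra.adjoin ℂ S := by
  have hBT := Algebra.adjoin_le_iff.1 h.le
  choose! U hUS hUf hU using fun t (ht : t ∈ T) =>
    exists_finite_subset_mem_adjoin (hBT (Or.inr ht))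
  have hsub : (⋃ t ∈ T, U t) ⊆ S := Set.iUnion₂_subset hUS
  refine ⟨⋃ t ∈ T, U t, hsub, hT.biUnion hUf, le_antisymm ?_ ?_⟩
  · exact Algebra.adjoin_le (Set.union_subset (fun b hb => hBT (Or.inl hb))
      (hsub.trans Algebra.subset_adjoin))
  · rw [← h]
    refine Algebra.adjoin_le (Set.union_subset
      (Set.subset_union_left.trans Algebra.subset_adjoin) fun t ht => ?_)
    exact Algebra.adjoin_mono ((Set.subset_biUnion_of_mem ht).trans Set.subset_union_right)
      (hU t ht)

end GaloisOrder

end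

theorem mainTheorem9 (𝒞 : GaloisOrder.Setting) (n : ℕ) (hn : 2 ≤ n)
    (m : Fin n → ℕ) [∀ k, NeZero (m k)]
    (𝒜 : Subalgebra ℂ (GaloisOrder.SkewRing (GaloisOrder.Idx m) 𝒞))
    (hstd : GaloisOrder.IsStandard m 𝒜)
    (hfg : GaloisOrder.FinitelyGeneratedOverInvariants (GaloisOrder.symRep m) 𝒜)
    (hpres : GaloisOrder.PreservesInvariantGerms (GaloisOrder.symRep m) 𝒜) :
    GaloisOrder.IsRationalGaloisOrder (GaloisOrder.symRep m) 𝒜 := by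
  obtain ⟨hinv, S, hS, hAS⟩ := hstd
  obtain ⟨T, hT, hAT⟩ := hfg
  obtain ⟨U, hUS, hU, hAU⟩ :=
    GaloisOrder.exists_finite_subset_adjoin_union_eq hT (hAT.symm.trans hAS)
  have hSA : S ⊆ 𝒜 := by rw [hAS]; exact Algebra.subset_adjoin
  obtain ⟨d, hd⟩ := GaloisOrder.exists_isRelativeInvariantGenerator (GaloisOrder.symRep m)
    (GaloisOrder.detCharacter (GaloisOrder.symRep m))
  refine ⟨hinv, ?_, U, hU, (hUS.trans hSA).trans hinv, fun X hX => ⟨_, d, hd, fun ξ => ?_⟩,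
    hAS.trans hAU.symm⟩
  · rw [hAT]
    exact Set.subset_union_left.trans Algebra.subset_adjoin
  · refine GaloisOrder.isRegular_mul_coeff ?_ (hpres X (hSA (hUS hX))) hd ξ
    exact Submodule.span_le.2 (GaloisOrder.standardElements_subset_axialElements 𝒞) (hS (hUS hX))
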